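/- Let $\mathfrak A$ be a real or complex Banach algebra (not necessarily unital). For $h\in\mathfrak A^*$ and $x\in\mathfrak A$ define $x\cdot h,\ h\cdot x\in\mathfrak A^*$ by $\langle y,x\cdot h\rangle=\langle yx,h\rangle$ and $\langle y,h\cdot x\rangle=\langle xy,h\rangle$. Let $\mathfrak A_{l,h}$ (resp. $\mathfrak A_{r,h}$) be the completion of the quotient of $\mathfrak A$ by the kernel of the seminorm $\|x\|_{l,h}=\|x\cdot h\|$ (resp. $\|x\|_{r,h}=\|h\cdot x\|$), with the induced norm. A non-empty absolutely convex set $C\subseteq\mathfrak A^*$ is called *autocompact* if the closed unit ball of the completion of $(\bigcup_{\lambda>0}\lambda C)/(\bigcap_{\lambda>0}\lambda C)$, normed by the gauge of $C$, is weakly compact. The functional $h$ is called *right-autoperiodic* (resp. *left-autoperiodic*) if the $\sigma(\mathfrak A^*,\mathfrak A)$-closure of $\{h\cdot a:\|a\|\le 1\}$ (resp. of $\{a\cdot h:\|a\|\le1\}$) is autocompact, and *autoperiodic* if it is right- or left-autoperiodic. A representation of $\mathfrak A$ on a Banach space $E$ is an algebra homomorphism $\pi:\mathfrak A\to B(E)$;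 it is norm-decreasing if $\|\pi(a)\|\le\|a\|$ for all $a$. Let $B$ be a linear subspace of $\mathfrak A^*$ which consists of autoperiodic functionals and separates the points of $\mathfrak A$. Then: 1. There are a reflexive Banach space $E$ and an injective norm-decreasing representation $\pi:\mathfrak A\to B(E)$. 2. For each $h\in B$ choose a label $s(h)\in\{l,r\}$ such that $h$ is right-autoperiodic if $s(h)=l$ and left-autoperiodic if $s(h)=r$. Then every space $\mathfrak A_{s(h),h}$ and the $\ell^2$-direct sum $\bigoplus_{h\in B}\mathfrak A_{s(h),h}$ are reflexive. Put $E_h=\mathfrak A_{l,h}$ if $s(h)=l$ and $E_h=(\mathfrak A_{r,h})^*$ if $s(h)=r$. Let $a\in\mathfrak A$ act on $\mathfrak A_{l,h}$ by the operator induced by $x\mapsto ax$, and on $(\mathfrak A_{r,h})^*$ by the transpose of the operator induced by $x\mapsto xa$. Then the $\ell^2$-direct sum $E=\bigoplus_{h\in B}E_h$ is a reflexive Banach space, and the coordinatewise action of $\mathfrak A$ on $E$ is a norm-decreasing representation $\pi:\mathfrak A\to B(E)$. If $\mathfrak A$ has an identity, $\pi$ is injective. -/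

import Mathlib

open scoped ENNReal

universe u

noncomputable section

/-! ### Reflexivity, and the completion of a vector space under a seminorm -/

/-- A normed space is reflexive when its canonical embedding in the bidual is onto. -/
def IsReflexiveSpace (𝕜 : Type*) [RCLike 𝕜] (E : Type*) [NormedAddCommGroup E]
    [NormedSpace 𝕜 E] : Prop :=
  Function.Surjective (NormedSpace.inclusionInDoubleDual 𝕜 E)

/-- The vector space `V` with the seminorm `p`. -/
def WithSeminorm {𝕜 : Type*} [RCLike 𝕜] {V : Type*} [AddCommGroup V] [Module 𝕜 V]
    (_p : Seminorm 𝕜 V) : Type _ := V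

namespace WithSeminorm

variable {𝕜 : Type*} [RCLike 𝕜] {V : Type*} [AddCommGroup V] [Module 𝕜 V] (p : Seminorm 𝕜 V)

instance instSeminormedAddCommGroup : SeminormedAddCommGroup (WithSeminorm p) :=
  AddGroupSeminorm.toSeminormedAddCommGroup (E := V) p.toAddGroupSeminorm

instance instModule : Module 𝕜 (WithSeminorm p) := inferInstanceAs (Module 𝕜 V)

/-- The identity map from `V` to `V` with the seminorm `p`. -/
def of : V ≃ₗ[𝕜] WithSeminorm p := LinearEquiv.refl 𝕜 V

theorem norm_of (x : V) : ‖of p x‖ = p x := rfl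

instance instNormedSpace : NormedSpace 𝕜 (WithSeminorm p) where
  norm_smul_le c x := (map_smul_eq_mul p c x).le

/-- The operator on `(V, p)` given by a linear map `T` with `p (T x) ≤ C * p x`. -/
def mapCLM (T : V →ₗ[𝕜] V) (C : ℝ) (hT : ∀ x, p (T x) ≤ C * p x) :
    WithSeminorm p →L[𝕜] WithSeminorm p :=
  LinearMap.mkContinuous
    ((of p).toLinearMap ∘ₗ T ∘ₗ (of p).symm.toLinearMap) C (fun x => hT ((of p).symm x))

end WithSeminorm

/-- The completion of the normed space `V / {x | p x = 0}` with the norm induced by `p`.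
(Mathlib's completion of a seminormed space is Hausdorff: it identifies points at distance
zero, so no separate quotient is needed.) -/
abbrev SeminormCompletion {𝕜 : Type*} [RCLike 𝕜] {V : Type*} [AddCommGroup V] [Module 𝕜 V]
    (p : Seminorm 𝕜 V) : Type _ :=
  UniformSpace.Completion (WithSeminorm p)

/-! ### Autocompact sets -/

/-- Non-empty absolutely convex sets. -/
structure IsAbsConvexSet (𝕜 : Type*) [RCLike 𝕜] {V : Type*} [AddCommGroup V] [Module 𝕜 V]
    [Module ℝ V] (C : Set V) : Prop where
  nonempty : C.Nonempty
  balanced : Balanced 𝕜 C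
  convex : Convex ℝ C

section Autocompact

variable {𝕜 : Type*} [RCLike 𝕜] {V : Type*} [AddCommGroup V] [Module 𝕜 V] [Module ℝ V]
  [IsScalarTower ℝ 𝕜 V] {C : Set V}

/-- The subspace `⋃_{r > 0} r C` of `V`. -/
def unionDilates (hC : IsAbsConvexSet 𝕜 C) : Submodule 𝕜 V where
  carrier := {x | ∃ r : ℝ, 0 < r ∧ ∃ y ∈ C, x = r • y}
  zero_mem' := by
    obtain ⟨y, hy⟩ := hC.nonempty
    have h0 : (0 : 𝕜) • y ∈ C := hC.balanced 0 (by simp) (Set.smul_mem_smul_set hy)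
    exact ⟨1, one_pos, 0, by simpa using h0, by simp⟩
  add_mem' := by
    rintro _ _ ⟨r, hr, y, hy, rfl⟩ ⟨t, ht, z, hz, rfl⟩
    have hrt : 0 < r + t := add_pos hr ht
    refine ⟨r + t, hrt, (r / (r + t)) • y + (t / (r + t)) • z, ?_, ?_⟩
    · exact hC.convex hy hz (by positivity) (by positivity) (by field_simp)
    · rw [smul_add, smul_smul, smul_smul, mul_div_cancel₀ _ hrt.ne', mul_div_cancel₀ _ hrt.ne']
  smul_mem' := by
    rintro c _ ⟨r, hr, y, hy, rfl⟩
    have hc : 0 < ‖c‖ + 1 := by positivity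
    refine ⟨(‖c‖ + 1) * r, by positivity, (c * ((‖c‖ + 1 : ℝ) : 𝕜)⁻¹) • y, ?_, ?_⟩
    · refine hC.balanced _ ?_ (Set.smul_mem_smul_set hy)
      rw [norm_mul, norm_inv, RCLike.norm_ofReal, abs_of_pos hc, ← div_eq_mul_inv]
      exact (div_le_one hc).2 (by linarith)
    · have hc' : ((‖c‖ + 1 : ℝ) : 𝕜) ≠ 0 := by exact_mod_cast hc.ne'
      rw [← algebraMap_smul 𝕜 r y, ← algebraMap_smul 𝕜 ((‖c‖ + 1) * r) _, smul_smul, smul_smul]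
      congr 1
      simp only [map_mul, RCLike.algebraMap_eq_ofReal]
      field_simp

theorem balanced_inUnion (hC : IsAbsConvexSet 𝕜 C) :
    Balanced 𝕜 ((↑) ⁻¹' C : Set (unionDilates hC)) := by
  rintro c hc _ ⟨y, hy, rfl⟩
  exact hC.balanced c hc (Set.smul_mem_smul_set hy)

theorem convex_inUnion (hC : IsAbsConvexSet 𝕜 C) :
    Convex ℝ ((↑) ⁻¹' C : Set (unionDilates hC)) := by
  intro x hx y hy a b ha hb hab
  exact hC.convex hx hy ha hb hab

theorem absorbent_inUnion (hC : IsAbsConvexSet 𝕜 C) :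
    Absorbent ℝ ((↑) ⁻¹' C : Set (unionDilates hC)) := by
  rintro ⟨_, r, hr, y, hy, rfl⟩
  refine Absorbs.of_norm ⟨r, fun c hc => ?_⟩
  have hc0 : c ≠ 0 := by
    rintro rfl
    simp at hc
    linarith
  rw [Set.singleton_subset_iff, Set.mem_smul_set_iff_inv_smul_mem₀ hc0]
  change c⁻¹ • r • y ∈ C
  rw [smul_smul, ← algebraMap_smul 𝕜 (c⁻¹ * r) y]
  refine hC.balanced _ ?_ (Set.smul_mem_smul_set hy)
  rw [RCLike.algebraMap_eq_ofReal, RCLike.norm_ofReal, abs_mul, abs_inv, abs_of_pos hr]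
  rw [Real.norm_eq_abs] at hc
  rw [inv_mul_eq_div]
  exact (div_le_one (lt_of_lt_of_le hr hc)).2 hc

/-- The gauge (Minkowski functional) of `C`, a seminorm on `⋃_{r > 0} r C`. -/
def unionGauge (hC : IsAbsConvexSet 𝕜 C) : Seminorm 𝕜 (unionDilates hC) :=
  gaugeSeminorm (balanced_inUnion hC) (convex_inUnion hC) (absorbent_inUnion hC)

variable (𝕜 C) in
/-- An absolutely convex set `C` is autocompact if the closed unit ball of the completion of
`(⋃_{r > 0} r C) / (⋂_{r > 0} r C)`, normed by the gauge of `C`, is weakly compact. -/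
def IsAutocompact : Prop :=
  ∃ hC : IsAbsConvexSet 𝕜 C,
    IsCompact (toWeakSpace 𝕜 (SeminormCompletion (unionGauge hC)) '' Metric.closedBall 0 1)

end Autocompact

/-! ### Autoperiodic functionals -/

section Functionals

variable {𝕜 : Type} [RCLike 𝕜] {A : Type u} [NonUnitalNormedRing A] [NormedSpace 𝕜 A]
  [IsScalarTower 𝕜 A A] [SMulCommClass 𝕜 A A]

/-- The functional `x · h : y ↦ h (y * x)`, as a linear function of `x`. -/
def leftAct (h : StrongDual 𝕜 A) : A →ₗ[𝕜] StrongDual 𝕜 A where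
  toFun x := h.comp ((ContinuousLinearMap.mul 𝕜 A).flip x)
  map_add' x y := by ext z; simp
  map_smul' c x := by ext z; simp

/-- The functional `h · x : y ↦ h (x * y)`, as a linear function of `x`. -/
def rightAct (h : StrongDual 𝕜 A) : A →ₗ[𝕜] StrongDual 𝕜 A where
  toFun x := h.comp (ContinuousLinearMap.mul 𝕜 A x)
  map_add' x y := by ext z; simp
  map_smul' c x := by ext z; simp

theorem leftAct_apply (h : StrongDual 𝕜 A) (x y : A) : leftAct h x y = h (y * x) := rfl

theorem rightAct_apply (h : StrongDual 𝕜 A) (x y : A) : rightAct h x y = h (x * y) := rfl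

/-- The `σ(A*, A)`-closure of a subset of `A*`. -/
def weakStarClosure (S : Set (StrongDual 𝕜 A)) : Set (StrongDual 𝕜 A) :=
  StrongDual.toWeakDual ⁻¹' closure (StrongDual.toWeakDual '' S)

/-- `h` is right-autoperiodic: the `σ(A*, A)`-closure of `{h · a | ‖a‖ ≤ 1}` is autocompact. -/
def IsRightAutoperiodic (h : StrongDual 𝕜 A) : Prop :=
  IsAutocompact 𝕜 (weakStarClosure (rightAct h '' Metric.closedBall 0 1))

/-- `h` is left-autoperiodic: the `σ(A*, A)`-closure of `{a · h | ‖a‖ ≤ 1}` is autocompact. -/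
def IsLeftAutoperiodic (h : StrongDual 𝕜 A) : Prop :=
  IsAutocompact 𝕜 (weakStarClosure (leftAct h '' Metric.closedBall 0 1))

variable (𝕜 A) in
/-- The set of autoperiodic functionals: those that are right- or left-autoperiodic. -/
def autoperiodicFunctionals : Set (StrongDual 𝕜 A) :=
  {h | IsRightAutoperiodic h ∨ IsLeftAutoperiodic h}

variable (𝕜 A) in
/-- Representations of `A` on `E`: algebra homomorphisms from `A` to the bounded operators on `E`. -/
abbrev OperatorRep (E : Type*) [NormedAddCommGroup E] [NormedSpace 𝕜 E] : Type _ :=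
  A →ₙₐ[𝕜] (E →L[𝕜] E)

/-- `π` is norm-decreasing: `‖π a‖ ≤ ‖a‖` for all `a`. -/
def IsNormDecreasing {E : Type*} [NormedAddCommGroup E] [NormedSpace 𝕜 E]
    (π : OperatorRep 𝕜 A E) : Prop :=
  ∀ a, ‖π a‖ ≤ ‖a‖

/-! ### The spaces attached to a functional -/

/-- Labels for the two spaces attached to a functional. -/
inductive Side : Type
  | left
  | right

/-- The seminorms `‖x‖_{l,h} = ‖x · h‖` and `‖x‖_{r,h} = ‖h · x‖` on `A`. -/
def sideSeminorm (s : Side) (h : StrongDual 𝕜 A) : Seminorm 𝕜 A :=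
  match s with
  | .left => (normSeminorm 𝕜 (StrongDual 𝕜 A)).comp (leftAct h)
  | .right => (normSeminorm 𝕜 (StrongDual 𝕜 A)).comp (rightAct h)

/-- The Banach spaces `A_{l,h}` and `A_{r,h}`: the completions of `A / {x | ‖x‖_{l,h} = 0}` and
`A / {x | ‖x‖_{r,h} = 0}`. -/
abbrev SideSpace (s : Side) (h : StrongDual 𝕜 A) : Type _ :=
  SeminormCompletion (sideSeminorm s h)

theorem sideSeminorm_left_mul_le (h : StrongDual 𝕜 A) (a x : A) :
    sideSeminorm .left h (a * x) ≤ ‖a‖ * sideSeminorm .left h x := by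
  change ‖leftAct h (a * x)‖ ≤ ‖a‖ * ‖leftAct h x‖
  refine ContinuousLinearMap.opNorm_le_bound _ (by positivity) (fun y => ?_)
  have h1 : leftAct h (a * x) y = leftAct h x (y * a) := by
    rw [leftAct_apply, leftAct_apply, mul_assoc]
  rw [h1]
  calc ‖leftAct h x (y * a)‖ ≤ ‖leftAct h x‖ * ‖y * a‖ := (leftAct h x).le_opNorm _
    _ ≤ ‖leftAct h x‖ * (‖y‖ * ‖a‖) := by gcongr; exact norm_mul_le _ _
    _ = ‖a‖ * ‖leftAct h x‖ * ‖y‖ := by ring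

theorem sideSeminorm_right_mul_le (h : StrongDual 𝕜 A) (a x : A) :
    sideSeminorm .right h (x * a) ≤ ‖a‖ * sideSeminorm .right h x := by
  change ‖rightAct h (x * a)‖ ≤ ‖a‖ * ‖rightAct h x‖
  refine ContinuousLinearMap.opNorm_le_bound _ (by positivity) (fun y => ?_)
  have h1 : rightAct h (x * a) y = rightAct h x (a * y) := by
    rw [rightAct_apply, rightAct_apply, mul_assoc]
  rw [h1]
  calc ‖rightAct h x (a * y)‖ ≤ ‖rightAct h x‖ * ‖a * y‖ := (rightAct h x).le_opNorm _
    _ ≤ ‖rightAct h x‖ * (‖a‖ * ‖y‖) := by gcongr; exact norm_mul_le _ _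
    _ = ‖a‖ * ‖rightAct h x‖ * ‖y‖ := by ring

/-- The operator on `A_{l,h}` that sends the class of `x` to the class of `a * x`. -/
def leftMulOp (h : StrongDual 𝕜 A) (a : A) : SideSpace .left h →L[𝕜] SideSpace .left h :=
  (WithSeminorm.mapCLM (sideSeminorm .left h) (LinearMap.mulLeft 𝕜 a) ‖a‖
    (sideSeminorm_left_mul_le h a)).completion

/-- The operator on `A_{r,h}` that sends the class of `x` to the class of `x * a`. -/
def rightMulOp (h : StrongDual 𝕜 A) (a : A) : SideSpace .right h →L[𝕜] SideSpace .right h :=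
  (WithSeminorm.mapCLM (sideSeminorm .right h) (LinearMap.mulRight 𝕜 a) ‖a‖
    (sideSeminorm_right_mul_le h a)).completion

/-- The space on which `A` is represented: `A_{l,h}` itself for the label `left`, and the dual of
`A_{r,h}` for the label `right` (on `A_{r,h}` the right multiplications form an
anti-representation, so that their transposes on the dual form a representation). -/
def RepSpace (s : Side) (h : StrongDual 𝕜 A) : Type u :=
  match s with
  | .left => SideSpace .left h
  | .right => StrongDual 𝕜 (SideSpace .right h)

instance instNormedAddCommGroupRepSpace (s : Side) (h : StrongDual 𝕜 A) :
    NormedAddCommGroup (RepSpace s h) :=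
  match s with
  | .left => inferInstanceAs (NormedAddCommGroup (SideSpace .left h))
  | .right => inferInstanceAs (NormedAddCommGroup (StrongDual 𝕜 (SideSpace .right h)))

instance instNormedSpaceRepSpace (s : Side) (h : StrongDual 𝕜 A) : NormedSpace 𝕜 (RepSpace s h) :=
  match s with
  | .left => inferInstanceAs (NormedSpace 𝕜 (SideSpace .left h))
  | .right => inferInstanceAs (NormedSpace 𝕜 (StrongDual 𝕜 (SideSpace .right h)))

/-- The action of `a` on `RepSpace s h`: on `A_{l,h}` the operator induced by `x ↦ a * x`, on the
dual of `A_{r,h}` the transpose of the operator induced by `x ↦ x * a`. -/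
def repOp (s : Side) (h : StrongDual 𝕜 A) (a : A) : RepSpace s h → RepSpace s h :=
  match s with
  | .left => fun v => leftMulOp h a v
  | .right => fun φ => ContinuousLinearMap.comp φ (rightMulOp h a)

/-- The `ℓ²`-direct sum of the spaces `A_{s(h),h}` over `h ∈ B`. -/
abbrev SideSum (B : Submodule 𝕜 (StrongDual 𝕜 A)) (s : B → Side) : Type u :=
  lp (fun h : B => SideSpace (s h) (h : StrongDual 𝕜 A)) 2

/-- The `ℓ²`-direct sum over `h ∈ B` of the spaces `RepSpace (s h) h`. -/
abbrev RepSum (B : Submodule 𝕜 (StrongDual 𝕜 A)) (s : B → Side) : Type u :=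
  lp (fun h : B => RepSpace (s h) (h : StrongDual 𝕜 A)) 2

end Functionals

end

/-! The heart of the matter is a duality. Since `(x · h) a = h (a * x) = (h · a) x`, the seminorm
`‖x · h‖` is the supremum of `‖f x‖` over `f` in `S = {h · a | ‖a‖ ≤ 1}`. Let `C` be the weak-star
closure of `S`. By Hahn–Banach (the bipolar theorem), every functional dominated by this seminorm
with constant one lies in `C`. Hence the unit ball of the dual of `A_{l,h}` is contained in the
image of the unit ball of the space normed by the gauge of `C`, under a bounded linear map. If `C`
is autocompact that image is weakly compact, so the dual of `A_{l,h}` is reflexive, and so is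
`A_{l,h}`. This is `IsAutocompact.isReflexiveSpace_seminormCompletion`; exchanging the sides gives
`A_{r,h}`.

Multiplication acts on these spaces by operators of norm at most `‖a‖`, and transposition turns the
anti-representation on `A_{r,h}` into a representation. `ℓ²`-sums preserve reflexivity
(`IsReflexiveSpace.lpTwo`) because a functional on such a sum is the norm-convergent sum of its
coordinate functionals. As `B` separates points, the sum is injective once the kernel of the
representation attached to each `h` lies in the kernel of `h`.

With an identity this follows by acting on the class of the identity. Without one it may fail: zero
multiplication gives zero operators. Then `SideExt` adds a coordinate for an adjoined unit and one
for the value of `h`, so that acting on the unit vector exhibits `h a`. -/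

/-! ### Weak-star separation -/

theorem WeakDual.isScalarTower_real {𝕜 X : Type*} [RCLike 𝕜] [NormedAddCommGroup X]
    [NormedSpace 𝕜 X] : IsScalarTower ℝ 𝕜 (WeakDual 𝕜 X) :=
  ⟨fun a c f => DFunLike.ext _ _ fun x => smul_assoc a c (f x)⟩

theorem WeakDual.locallyConvexSpace_real {𝕜 X : Type*} [RCLike 𝕜] [NormedAddCommGroup X]
    [NormedSpace 𝕜 X] : LocallyConvexSpace ℝ (WeakDual 𝕜 X) :=
  inferInstanceAs (LocallyConvexSpace ℝ (WeakBilin (topDualPairing 𝕜 X)))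

/-- A point outside a weak-star closed convex set of functionals is separated from it by an
evaluation functional. -/
theorem WeakDual.exists_re_apply_lt {𝕜 X : Type*} [RCLike 𝕜] [NormedAddCommGroup X]
    [NormedSpace 𝕜 X] {C : Set (WeakDual 𝕜 X)} (hconv : Convex ℝ C) (hcl : IsClosed C)
    {ψ : WeakDual 𝕜 X} (hψ : ψ ∉ C) :
    ∃ (x : X) (r : ℝ), (∀ f ∈ C, RCLike.re (f x) < r) ∧ r < RCLike.re (ψ x) := by
  obtain ⟨F, r, hF, hr⟩ := @RCLike.geometric_hahn_banach_closed_point 𝕜 (WeakDual 𝕜 X) _ _ _ C ψ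
    _ _ WeakDual.isScalarTower_real _ _ WeakDual.locallyConvexSpace_real hconv hcl hψ
  -- Weak-star continuous functionals are evaluations at points.
  obtain ⟨x, rfl⟩ := LinearMap.dualEmbedding_surjective (topDualPairing 𝕜 X) F
  exact ⟨x, r, hF, hr⟩

/-- A weak-star closed, balanced and convex set of functionals contains every functional that is
dominated by it. -/
theorem StrongDual.mem_of_forall_norm_apply_le {𝕜 X : Type*} [RCLike 𝕜] [NormedAddCommGroup X]
    [NormedSpace 𝕜 X] {C : Set (StrongDual 𝕜 X)} (hbal : Balanced 𝕜 C) (hconv : Convex ℝ C)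
    (hcl : IsClosed (StrongDual.toWeakDual '' C)) {ψ : StrongDual 𝕜 X}
    (hψ : ∀ x r, (∀ f ∈ C, ‖f x‖ ≤ r) → ‖ψ x‖ ≤ r) : ψ ∈ C := by
  by_contra hmem
  have hconv' : Convex ℝ (StrongDual.toWeakDual '' C) := by
    rintro _ ⟨f, hf, rfl⟩ _ ⟨g, hg, rfl⟩ a b ha hb hab
    exact ⟨a • f + b • g, hconv hf hg ha hb hab, rfl⟩
  have hmem' : StrongDual.toWeakDual ψ ∉ StrongDual.toWeakDual '' C := by
    rintro ⟨f, hf, hfψ⟩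
    rw [StrongDual.toWeakDual_inj] at hfψ
    exact hmem (hfψ ▸ hf)
  obtain ⟨x, r, hF, hr⟩ := WeakDual.exists_re_apply_lt hconv' hcl hmem'
  have hle : ‖ψ x‖ ≤ r := by
    refine hψ x r fun f hf => ?_
    -- Balancedness allows `f` to be rotated until `f x` equals its norm, so the bound on real parts
    -- bounds norms.
    obtain ⟨c, hc, hcf⟩ := RCLike.exists_norm_eq_mul_self (f x)
    have hmemc : c • f ∈ C := hbal c hc.le (Set.smul_mem_smul_set hf)
    have : RCLike.re (c * f x) < r := hF _ ⟨_, hmemc, rfl⟩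
    rw [← hcf, RCLike.ofReal_re] at this
    exact this.le
  have := (RCLike.re_le_norm (ψ x)).trans hle
  rw [StrongDual.toWeakDual_apply] at hr
  linarith

/-! ### Criteria for reflexivity and its permanence properties -/

namespace IsReflexiveSpace

variable {𝕜 : Type*} [RCLike 𝕜]

/-- A normed space with weakly compact unit ball is reflexive. -/
theorem of_isCompact_closedBall {G : Type*} [NormedAddCommGroup G] [NormedSpace 𝕜 G]
    (h : IsCompact (toWeakSpace 𝕜 G '' Metric.closedBall 0 1)) : IsReflexiveSpace 𝕜 G := by
  set J := NormedSpace.inclusionInDoubleDual 𝕜 G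
  -- The image of the ball is weak-star compact, hence weak-star closed, and it norms every
  -- functional `f`; the bipolar argument then places `Φ` in it.
  have hball : ∀ Φ : StrongDual 𝕜 (StrongDual 𝕜 G), ‖Φ‖ ≤ 1 → Φ ∈ J '' Metric.closedBall 0 1 := by
    intro Φ hΦ
    refine StrongDual.mem_of_forall_norm_apply_le ?_ ?_ ?_ ?_
    · rintro c hc _ ⟨_, ⟨x, hx, rfl⟩, rfl⟩
      refine ⟨c • x, ?_, by simp⟩
      rw [mem_closedBall_zero_iff] at hx ⊢
      rw [norm_smul]
      exact mul_le_one₀ hc (norm_nonneg _) hx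
    · rintro _ ⟨x, hx, rfl⟩ _ ⟨y, hy, rfl⟩ a b ha hb hab
      let _ : NormedSpace ℝ G := NormedSpace.restrictScalars ℝ 𝕜 G
      refine ⟨a • x + b • y, convex_closedBall (0 : G) 1 hx hy ha hb hab, ?_⟩
      ext f
      have key : ∀ (t : ℝ) (z : G), f (t • z) = t • f z := fun t z => by
        change f ((algebraMap ℝ 𝕜 t) • z) = _
        rw [map_smul, algebraMap_smul]
      change f (a • x + b • y) = a • f x + b • f y
      rw [map_add, key, key]
    · let j : WeakSpace 𝕜 G → WeakDual 𝕜 (StrongDual 𝕜 G) :=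
        fun x => StrongDual.toWeakDual (J ((toWeakSpace 𝕜 G).symm x))
      have hj : Continuous j := WeakDual.continuous_of_continuous_eval fun f =>
        WeakBilin.eval_continuous (topDualPairing 𝕜 G).flip f
      have := (h.image hj).isClosed
      convert this using 1
      simp only [Set.image_image, j, LinearEquiv.symm_apply_apply]
    · intro f r hf
      have hr : 0 ≤ r := by
        simpa using hf 0 ⟨0, by simp, by simp⟩
      have hfr : ‖f‖ ≤ r := ContinuousLinearMap.opNorm_le_of_unit_norm hr fun x hx =>
        hf _ ⟨x, by simp [hx], rfl⟩
      calc ‖Φ f‖ ≤ ‖Φ‖ * ‖f‖ := Φ.le_opNorm f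
        _ ≤ 1 * r := by gcongr
        _ = r := one_mul r
  intro Φ
  -- Dividing by `‖Φ‖ + 1` rather than `‖Φ‖` covers `Φ = 0`.
  obtain ⟨x, -, hx⟩ := hball (((‖Φ‖ + 1 : ℝ) : 𝕜)⁻¹ • Φ) (by
    refine (ContinuousLinearMap.opNorm_smul_le _ Φ).trans ?_
    rw [norm_inv, RCLike.norm_ofReal, abs_of_pos (by positivity),
      inv_mul_le_one₀ (by positivity)]
    linarith)
  have hc : ((‖Φ‖ + 1 : ℝ) : 𝕜) ≠ 0 := by
    have : 0 < ‖Φ‖ + 1 := by positivity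
    exact_mod_cast this.ne'
  exact ⟨((‖Φ‖ + 1 : ℝ) : 𝕜) • x, by rw [map_smul]; change _ • J x = _; rw [hx, smul_inv_smul₀ hc]⟩

/-- The dual of a reflexive space is reflexive. -/
theorem dual {E : Type*} [NormedAddCommGroup E] [NormedSpace 𝕜 E] (hE : IsReflexiveSpace 𝕜 E) :
    IsReflexiveSpace 𝕜 (StrongDual 𝕜 E) := by
  intro Ψ
  refine ⟨Ψ.comp (NormedSpace.inclusionInDoubleDual 𝕜 E), ?_⟩
  ext Φ
  obtain ⟨x, rfl⟩ := hE Φ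
  rfl

/-- A Banach space with reflexive dual is reflexive. -/
theorem of_dual {E : Type*} [NormedAddCommGroup E] [NormedSpace 𝕜 E] [CompleteSpace E]
    (hE : IsReflexiveSpace 𝕜 (StrongDual 𝕜 E)) : IsReflexiveSpace 𝕜 E := by
  intro Φ
  set J := NormedSpace.inclusionInDoubleDualLi 𝕜 (E := E)
  have hclosed : IsClosed (Set.range J) := 
    (completeSpace_iff_isComplete_range J.isometry.isUniformInducing).1 inferInstance |>.isClosed
  have hconv : Convex ℝ (Set.range J) := by
    rintro _ ⟨x, rfl⟩ _ ⟨y, rfl⟩ a b - - -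
    refine ⟨(a : 𝕜) • x + (b : 𝕜) • y, ?_⟩
    rw [map_add, map_smul, map_smul, ← algebraMap_smul 𝕜 a (J x), ← algebraMap_smul 𝕜 b (J y)]
  by_contra hΦ
  obtain ⟨Ψ, r, hΨ, hr⟩ := RCLike.geometric_hahn_banach_closed_point (𝕜 := 𝕜) hconv hclosed hΦ
  obtain ⟨f, rfl⟩ := hE Ψ
  -- The real part of `f` stays below `r` on all of `E`; where `f x ≠ 0`, a multiple of `x` would
  -- give it the value `r`.
  have hf : f = 0 := by
    ext x
    by_contra hx
    have := hΨ _ ⟨(r * (f x)⁻¹ : 𝕜) • x, rfl⟩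
    change RCLike.re (f ((r * (f x)⁻¹ : 𝕜) • x)) < r at this
    rw [map_smul, smul_eq_mul, inv_mul_cancel_right₀ hx, RCLike.ofReal_re] at this
    exact lt_irrefl _ this
  have h0 := hΨ _ ⟨0, rfl⟩
  rw [hf] at h0 hr
  simp only [map_zero] at h0 hr
  exact lt_asymm h0 hr

/-- Reflexivity is invariant under linear homeomorphisms. -/
theorem congr {E F : Type*} [NormedAddCommGroup E] [NormedSpace 𝕜 E] [NormedAddCommGroup F]
    [NormedSpace 𝕜 F] (e : E ≃L[𝕜] F) (hE : IsReflexiveSpace 𝕜 E) : IsReflexiveSpace 𝕜 F := by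
  intro Φ
  obtain ⟨x, hx⟩ := hE (Φ.comp (ContinuousLinearMap.precomp 𝕜 (e.symm : F →L[𝕜] E)))
  refine ⟨e x, ?_⟩
  ext f
  have := congrArg (fun Ψ => Ψ (f.comp (e : E →L[𝕜] F))) hx
  simp only [NormedSpace.dual_def, ContinuousLinearMap.comp_apply] at this
  refine this.trans (congrArg Φ ?_)
  ext y
  simp

/-- The scalar field is reflexive. -/
theorem self : IsReflexiveSpace 𝕜 𝕜 := by
  intro Φ
  refine ⟨Φ (ContinuousLinearMap.id 𝕜 𝕜), ?_⟩
  ext f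
  have hf : f = f 1 • ContinuousLinearMap.id 𝕜 𝕜 := by ext; simp
  rw [NormedSpace.dual_def]
  conv_rhs => rw [hf, map_smul]
  conv_lhs => rw [hf]
  simp

/-- Products of reflexive spaces are reflexive. -/
theorem prod {E F : Type*} [NormedAddCommGroup E] [NormedSpace 𝕜 E] [NormedAddCommGroup F]
    [NormedSpace 𝕜 F] (hE : IsReflexiveSpace 𝕜 E) (hF : IsReflexiveSpace 𝕜 F) :
    IsReflexiveSpace 𝕜 (E × F) := by
  intro Φ
  obtain ⟨x, hx⟩ := hE (Φ.comp (ContinuousLinearMap.precomp 𝕜 (.fst 𝕜 E F)))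
  obtain ⟨y, hy⟩ := hF (Φ.comp (ContinuousLinearMap.precomp 𝕜 (.snd 𝕜 E F)))
  refine ⟨(x, y), ?_⟩
  ext f
  have h1 := congrArg (fun Ψ => Ψ (f.comp (.inl 𝕜 E F))) hx
  have h2 := congrArg (fun Ψ => Ψ (f.comp (.inr 𝕜 E F))) hy
  simp only [NormedSpace.dual_def, ContinuousLinearMap.comp_apply] at h1 h2
  have hxy : f (x, y) = f (ContinuousLinearMap.inl 𝕜 E F x) + f (ContinuousLinearMap.inr 𝕜 E F y) := by
    rw [← map_add]; simp
  rw [NormedSpace.dual_def, hxy, h1, h2, ← map_add]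
  congr 1
  ext z <;> simp [← Prod.zero_eq_mk]

/-- Functionals on a reflexive space attain their norm. -/
theorem exists_apply_eq_norm {E : Type*} [NormedAddCommGroup E] [NormedSpace 𝕜 E]
    (hE : IsReflexiveSpace 𝕜 E) (f : StrongDual 𝕜 E) : ∃ x : E, ‖x‖ ≤ 1 ∧ f x = ‖f‖ := by
  obtain ⟨Φ, hΦ, hΦf⟩ := exists_dual_vector'' 𝕜 f
  obtain ⟨x, rfl⟩ := hE Φ
  exact ⟨x, by rwa [← (NormedSpace.inclusionInDoubleDualLi 𝕜 (E := E)).norm_map x], hΦf⟩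

end IsReflexiveSpace

/-! ### `ℓ²`-direct sums of reflexive spaces -/

section LpTwo

variable {𝕜 : Type*} [RCLike 𝕜] {ι : Type*} {E : ι → Type*} [∀ i, NormedAddCommGroup (E i)]
  [∀ i, NormedSpace 𝕜 (E i)]

theorem lp.sum_sq_norm_le (x : lp E 2) (s : Finset ι) : ∑ i ∈ s, ‖x i‖ ^ 2 ≤ ‖x‖ ^ 2 := by
  have := lp.sum_rpow_le_norm_rpow (p := 2) (by norm_num) x s
  simpa using this

/-- Cauchy–Schwarz; it makes square-summability of the norms `‖ψ i‖` enough for norm convergence of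
the sum. -/
theorem lp.norm_sum_comp_evalCLM_le (ψ : ∀ i, StrongDual 𝕜 (E i)) (s : Finset ι) :
    ‖∑ i ∈ s, (ψ i).comp (lp.evalCLM 𝕜 E 2 i)‖ ≤ √(∑ i ∈ s, ‖ψ i‖ ^ 2) := by
  refine ContinuousLinearMap.opNorm_le_bound _ (Real.sqrt_nonneg _) fun x => ?_
  rw [sum_apply]
  calc ‖∑ i ∈ s, ψ i (x i)‖ ≤ ∑ i ∈ s, ‖ψ i‖ * ‖x i‖ :=
        norm_sum_le_of_le _ fun i _ => (ψ i).le_opNorm _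
    _ ≤ √(∑ i ∈ s, ‖ψ i‖ ^ 2) * √(∑ i ∈ s, ‖x i‖ ^ 2) := Real.sum_mul_le_sqrt_mul_sqrt _ _ _
    _ ≤ √(∑ i ∈ s, ‖ψ i‖ ^ 2) * ‖x‖ := by
        gcongr
        exact Real.sqrt_le_iff.2 ⟨norm_nonneg _, lp.sum_sq_norm_le x s⟩

/-- For the two duality estimates below, where a partial sum `a` of squares is the value of a
functional of norm `c` at a vector of norm at most `√a`. -/
theorem le_sq_of_le_mul_sqrt {a c : ℝ} (ha : 0 ≤ a) (h : a ≤ c * √a) : a ≤ c ^ 2 := by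
  have hs := Real.sq_sqrt ha
  rcases (Real.sqrt_nonneg a).eq_or_lt with h0 | h0
  · rw [← h0] at hs
    nlinarith [sq_nonneg c]
  · have h1 : √a ≤ c := by
      by_contra! hlt
      nlinarith
    nlinarith

/-- Reflexivity supplies vectors at which the coordinate functionals attain their norms. Testing `φ`
on finite combinations of them shows that these norms are square-summable, so the series converges
in norm; its limit agrees with `φ` because every `x` is the sum of its coordinates. -/
theorem lp.hasSum_comp_single_comp_evalCLM [DecidableEq ι] (hE : ∀ i, IsReflexiveSpace 𝕜 (E i))
    (φ : StrongDual 𝕜 (lp E 2)) :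
    HasSum (fun i => (φ.comp (lp.singleContinuousLinearMap 𝕜 E 2 i)).comp (lp.evalCLM 𝕜 E 2 i))
      φ := by
  set ψ : ∀ i, StrongDual 𝕜 (E i) := fun i => φ.comp (lp.singleContinuousLinearMap 𝕜 E 2 i)
  have hψ : ∀ s : Finset ι, ∑ i ∈ s, ‖ψ i‖ ^ 2 ≤ ‖φ‖ ^ 2 := by
    intro s
    choose x hx1 hx using fun i => (hE i).exists_apply_eq_norm (ψ i)
    -- The weights `‖ψ i‖` are the equality case of Cauchy–Schwarz: `φ v` becomes the sum of
    -- squares.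
    set v : lp E 2 := ∑ i ∈ s, lp.single 2 i ((‖ψ i‖ : 𝕜) • x i)
    have hv : ‖v‖ ≤ √(∑ i ∈ s, ‖ψ i‖ ^ 2) := by
      apply Real.le_sqrt_of_sq_le
      have := lp.norm_sum_single (p := 2) (by norm_num) (fun i => (‖ψ i‖ : 𝕜) • x i) s
      simp only [ENNReal.toReal_ofNat, Real.rpow_ofNat] at this
      rw [this]
      gcongr with i hi
      rw [norm_smul, RCLike.norm_ofReal, abs_norm]
      exact mul_le_of_le_one_right (norm_nonneg _) (hx1 i)
    have hφv : φ v = ((∑ i ∈ s, ‖ψ i‖ ^ 2 : ℝ) : 𝕜) := by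
      rw [map_sum]
      push_cast
      refine Finset.sum_congr rfl fun i _ => ?_
      change ψ i _ = _
      rw [map_smul, hx, smul_eq_mul, sq]
    refine le_sq_of_le_mul_sqrt (by positivity) ?_
    calc ∑ i ∈ s, ‖ψ i‖ ^ 2 = ‖φ v‖ := by
          rw [hφv, RCLike.norm_ofReal, abs_of_nonneg (by positivity)]
      _ ≤ ‖φ‖ * ‖v‖ := φ.le_opNorm v
      _ ≤ _ := by gcongr
  have hsummable : Summable fun i => ‖ψ i‖ ^ 2 :=
    summable_of_sum_le (fun _ => by positivity) hψ
  have hS : Summable fun i => (ψ i).comp (lp.evalCLM 𝕜 E 2 i) := by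
    rw [summable_iff_vanishing_norm] at hsummable ⊢
    intro ε hε
    obtain ⟨s, hs⟩ := hsummable (ε ^ 2) (by positivity)
    refine ⟨s, fun t ht => (lp.norm_sum_comp_evalCLM_le ψ t).trans_lt ?_⟩
    rw [Real.sqrt_lt' hε]
    exact (le_abs_self _).trans_lt (hs t ht)
  obtain ⟨φ', hφ'⟩ := hS
  convert hφ' using 1
  ext x
  have h1 := (lp.hasSum_single (p := 2) (by norm_num) x).mapL φ
  have h2 := hφ'.mapL (ContinuousLinearMap.apply 𝕜 𝕜 x)
  exact h1.unique h2

/-- The `ℓ²`-direct sum of reflexive spaces is reflexive. -/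
theorem IsReflexiveSpace.lpTwo (hE : ∀ i, IsReflexiveSpace 𝕜 (E i)) :
    IsReflexiveSpace 𝕜 (lp E 2) := by
  classical
  intro Φ
  -- The candidate preimage of `Φ`: its coordinate `e i` represents `Φ` on the functionals that
  -- depend on the `i`-th coordinate only.
  choose e he using fun i => hE i (Φ.comp (ContinuousLinearMap.precomp 𝕜 (lp.evalCLM 𝕜 E 2 i)))
  have he' : ∀ i (ψ : StrongDual 𝕜 (E i)), Φ (ψ.comp (lp.evalCLM 𝕜 E 2 i)) = ψ (e i) :=
    fun i ψ => (congrArg (fun Ψ => Ψ ψ) (he i)).symm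
  have hmem : Memℓp e 2 := by
    refine memℓp_gen' (C := ‖Φ‖ ^ 2) fun s => ?_
    simp only [ENNReal.toReal_ofNat, Real.rpow_ofNat]
    -- Square-summability of `e` is dual to the previous estimate, with norming functionals in place
    -- of norming vectors.
    choose g hg1 hg using fun i => exists_dual_vector'' 𝕜 (e i)
    set ψ : ∀ i, StrongDual 𝕜 (E i) := fun i => (‖e i‖ : 𝕜) • g i
    have hψ : √(∑ i ∈ s, ‖ψ i‖ ^ 2) ≤ √(∑ i ∈ s, ‖e i‖ ^ 2) := by
      refine Real.sqrt_le_sqrt ?_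
      gcongr with i hi
      rw [norm_smul, RCLike.norm_ofReal, abs_norm]
      exact mul_le_of_le_one_right (norm_nonneg _) (hg1 i)
    have hΦ : Φ (∑ i ∈ s, (ψ i).comp (lp.evalCLM 𝕜 E 2 i)) = ((∑ i ∈ s, ‖e i‖ ^ 2 : ℝ) : 𝕜) := by
      rw [map_sum]
      push_cast
      refine Finset.sum_congr rfl fun i _ => ?_
      rw [he', smul_apply, hg, smul_eq_mul, sq]
    refine le_sq_of_le_mul_sqrt (by positivity) ?_
    calc ∑ i ∈ s, ‖e i‖ ^ 2 = ‖Φ (∑ i ∈ s, (ψ i).comp (lp.evalCLM 𝕜 E 2 i))‖ := by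
          rw [hΦ, RCLike.norm_ofReal, abs_of_nonneg (by positivity)]
      _ ≤ ‖Φ‖ * ‖∑ i ∈ s, (ψ i).comp (lp.evalCLM 𝕜 E 2 i)‖ := Φ.le_opNorm _
      _ ≤ _ := by
        gcongr
        exact (lp.norm_sum_comp_evalCLM_le ψ s).trans hψ
  refine ⟨⟨e, hmem⟩, ?_⟩
  ext φ
  have h1 := (lp.hasSum_comp_single_comp_evalCLM hE φ).mapL Φ
  have h2 := (lp.hasSum_single (p := 2) (by norm_num) (⟨e, hmem⟩ : lp E 2)).mapL φ
  simp only [he'] at h1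
  exact h2.unique h1

end LpTwo

/-! ### From autocompactness to reflexivity -/

namespace IsReflexiveSpace

variable {𝕜 : Type*} [RCLike 𝕜]

/-- A normed space whose unit ball is contained in a weakly compact set is reflexive. -/
theorem of_closedBall_subset {G : Type*} [NormedAddCommGroup G] [NormedSpace 𝕜 G] {K : Set G}
    (hK : IsCompact (toWeakSpace 𝕜 G '' K)) (hball : Metric.closedBall 0 1 ⊆ K) :
    IsReflexiveSpace 𝕜 G := by
  refine of_isCompact_closedBall (hK.of_isClosed_subset ?_ (Set.image_mono hball))
  let _ : NormedSpace ℝ G := NormedSpace.restrictScalars ℝ 𝕜 G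
  have : IsScalarTower ℝ 𝕜 G := ⟨fun a c x => by
    change (a • c) • x = (algebraMap ℝ 𝕜 a) • (c • x)
    rw [smul_smul, Algebra.smul_def]⟩
  -- By Mazur's theorem the norm-closed convex ball is weakly closed.
  have := (convex_closedBall (0 : G) 1).toWeakSpace_closure 𝕜
  rw [Metric.isClosed_closedBall.closure_eq] at this
  rw [this]
  exact isClosed_closure

end IsReflexiveSpace

section ExtendDual

variable {𝕜 : Type*} [RCLike 𝕜] {V : Type*} [SeminormedAddCommGroup V] [NormedSpace 𝕜 V]

theorem norm_fromCompletion_le {W : Type*} [NormedAddCommGroup W] [NormedSpace 𝕜 W]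
    [CompleteSpace W] (f : V →L[𝕜] W) : ‖f.fromCompletion‖ ≤ ‖f‖ := by
  refine ContinuousLinearMap.opNorm_le_bound _ (norm_nonneg f) fun y => ?_
  induction y using UniformSpace.Completion.induction_on with
  | hp => exact isClosed_le (by fun_prop) (by fun_prop)
  | ih x =>
    rw [ContinuousLinearMap.fromCompletion_apply_coe, UniformSpace.Completion.norm_coe]
    exact f.le_opNorm x

variable (𝕜 V) in
/-- The extension of functionals to the completion, as a bounded linear map. -/
noncomputable def extendDual : StrongDual 𝕜 V →L[𝕜] StrongDual 𝕜 (UniformSpace.Completion V) :=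
  LinearMap.mkContinuous
    { toFun f := f.fromCompletion
      map_add' f g := (f + g).fromCompletion_unique _ fun x => by simp
      map_smul' c f := (c • f).fromCompletion_unique _ fun x => by simp }
    1 fun f => by simpa using norm_fromCompletion_le f

theorem extendDual_apply_coe (f : StrongDual 𝕜 V) (x : V) : extendDual 𝕜 V f x = f x :=
  f.fromCompletion_apply_coe x

end ExtendDual

/-- A bound on `C` scales to its dilates. The infimum defining the gauge need not be attained, so
the estimate is proved for each `a` above the gauge and `a` then decreases to it. -/
theorem norm_apply_le_unionGauge_mul {𝕜 : Type*} [RCLike 𝕜] {V : Type*} [AddCommGroup V]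
    [Module 𝕜 V] [Module ℝ V] [IsScalarTower ℝ 𝕜 V] {C : Set V} (hC : IsAbsConvexSet 𝕜 C)
    (e : V →ₗ[𝕜] 𝕜) {M : ℝ} (he : ∀ v ∈ C, ‖e v‖ ≤ M) (v : unionDilates hC) :
    ‖e v‖ ≤ unionGauge hC v * M := by
  have key : ∀ a, unionGauge hC v < a → ‖e v‖ ≤ a * M := by
    intro a ha
    obtain ⟨b, hb, hba, w, hw, hwv⟩ := exists_lt_of_gauge_lt (absorbent_inUnion hC) ha
    have hev : e v = (b : 𝕜) * e w := by
      rw [← hwv]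
      change e (b • (w : V)) = _
      rw [← algebraMap_smul 𝕜 b (w : V), map_smul]
      rfl
    calc ‖e v‖ = b * ‖e w‖ := by rw [hev, norm_mul, RCLike.norm_ofReal, abs_of_pos hb]
      _ ≤ a * M := mul_le_mul hba.le (he _ hw) (norm_nonneg _) (hb.trans hba).le
  have hlim : Filter.Tendsto (fun a : ℝ => a * M)
      (nhdsWithin (unionGauge hC v) (Set.Ioi (unionGauge hC v))) (nhds (unionGauge hC v * M)) :=
    ((continuous_id.mul continuous_const).tendsto _).mono_left nhdsWithin_le_nhds
  exact ge_of_tendsto hlim (Filter.eventually_of_mem self_mem_nhdsWithin key)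

section Autocompact

variable {𝕜 : Type} [RCLike 𝕜] {A : Type u} [NonUnitalNormedRing A] [NormedSpace 𝕜 A]

/-- If the weak-star closure of `S` is autocompact, then the completion of `A` under the support
seminorm of `S` is reflexive. -/
theorem IsAutocompact.isReflexiveSpace_seminormCompletion {S : Set (StrongDual 𝕜 A)}
    (hS : IsAutocompact 𝕜 (weakStarClosure S)) (p : Seminorm 𝕜 A) {K : ℝ}
    (hpK : ∀ x, p x ≤ K * ‖x‖) (hp : ∀ f ∈ S, ∀ x, ‖f x‖ ≤ p x)
    (hp' : ∀ x r, (∀ f ∈ S, ‖f x‖ ≤ r) → p x ≤ r) :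
    IsReflexiveSpace 𝕜 (SeminormCompletion p) := by
  obtain ⟨hC, hcomp⟩ := hS
  have hCp : ∀ f ∈ weakStarClosure S, ∀ x, ‖f x‖ ≤ p x := by
    intro f hf x
    have hcont : Continuous fun f : WeakDual 𝕜 A => f x := WeakDual.eval_continuous x
    have hclosed : IsClosed {f : WeakDual 𝕜 A | ‖f x‖ ≤ p x} :=
      isClosed_Iic.preimage (continuous_norm.comp hcont)
    have hsub : StrongDual.toWeakDual '' S ⊆ {f : WeakDual 𝕜 A | ‖f x‖ ≤ p x} := by
      rintro _ ⟨g, hg, rfl⟩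
      exact hp g hg x
    have hf' : StrongDual.toWeakDual f ∈ closure (StrongDual.toWeakDual '' S) := hf
    exact closure_minimal hsub hclosed hf'
  have hSC : S ⊆ weakStarClosure S := fun f hf =>
    (subset_closure ⟨f, hf, rfl⟩ :
      StrongDual.toWeakDual f ∈ closure (StrongDual.toWeakDual '' S))
  have hCcl : IsClosed (StrongDual.toWeakDual '' weakStarClosure S) := by
    rw [weakStarClosure, Set.image_preimage_eq _ StrongDual.toWeakDual.surjective]
    exact isClosed_closure
  -- Functionals in the span of `C` are bounded for `p` with constant their gauge, so they act on
  -- `(A, p)`.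
  let Θ₀ : WithSeminorm (unionGauge hC) →L[𝕜] StrongDual 𝕜 (WithSeminorm p) :=
    LinearMap.mkContinuous₂
      ((LinearMap.lcomp 𝕜 𝕜 (WithSeminorm.of p).symm.toLinearMap) ∘ₗ
        (ContinuousLinearMap.coeLM 𝕜 : StrongDual 𝕜 A →ₗ[𝕜] A →ₗ[𝕜] 𝕜) ∘ₗ
        (unionDilates hC).subtype ∘ₗ (WithSeminorm.of (unionGauge hC)).symm.toLinearMap) 1
      fun f x => by
        rw [one_mul]
        exact norm_apply_le_unionGauge_mul hC
          (LinearMap.applyₗ x ∘ₗ (ContinuousLinearMap.coeLM 𝕜 : StrongDual 𝕜 A →ₗ[𝕜] A →ₗ[𝕜] 𝕜))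
          (fun g hg => hCp g hg x) _
  let Θ : SeminormCompletion (unionGauge hC) →L[𝕜] StrongDual 𝕜 (SeminormCompletion p) :=
    ((extendDual 𝕜 (WithSeminorm p)).comp Θ₀).fromCompletion
  refine .of_dual (.of_closedBall_subset (K := Θ '' Metric.closedBall 0 1) ?_ ?_)
  · convert hcomp.image (WeakSpace.map Θ).continuous using 1
    rw [Set.image_image, Set.image_image]
    rfl
  · intro ψ hψ
    rw [mem_closedBall_zero_iff] at hψ
    have hψp : ∀ x : A, ‖ψ (WithSeminorm.of p x : SeminormCompletion p)‖ ≤ p x := fun x =>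
      (ψ.le_of_opNorm_le hψ _).trans_eq (by
        rw [one_mul, UniformSpace.Completion.norm_coe, WithSeminorm.norm_of])
    let f : StrongDual 𝕜 A := LinearMap.mkContinuous
      (ψ.toLinearMap ∘ₗ (UniformSpace.Completion.toComplL (𝕜 := 𝕜)).toLinearMap ∘ₗ
        (WithSeminorm.of p).toLinearMap) K fun x => (hψp x).trans (hpK x)
    -- The bipolar step: `p` is the least bound given by `S`, so a functional dominated by `p`
    -- belongs to the closure and has gauge at most one.
    have hf : f ∈ weakStarClosure S :=
      StrongDual.mem_of_forall_norm_apply_le hC.balanced hC.convex hCcl fun x r hr =>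
        (hψp x).trans (hp' x r fun g hg => hr g (hSC hg))
    let F : unionDilates hC := ⟨f, 1, one_pos, f, hf, (one_smul ℝ f).symm⟩
    refine ⟨(WithSeminorm.of (unionGauge hC) F : SeminormCompletion (unionGauge hC)), ?_, ?_⟩
    · rw [mem_closedBall_zero_iff, UniformSpace.Completion.norm_coe, WithSeminorm.norm_of]
      exact gauge_le_one_of_mem hf
    · refine (ContinuousLinearMap.fromCompletion_apply_coe _ _).trans ?_
      ext y
      induction y using UniformSpace.Completion.induction_on with
      | hp => exact isClosed_eq (ContinuousLinearMap.continuous _) ψ.continuous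
      | ih x => exact extendDual_apply_coe _ _

variable [IsScalarTower 𝕜 A A] [SMulCommClass 𝕜 A A]

theorem sideSeminorm_le (s : Side) (h : StrongDual 𝕜 A) (x : A) :
    sideSeminorm s h x ≤ ‖h‖ * ‖x‖ := by
  cases s
  · refine ContinuousLinearMap.opNorm_le_bound _ (by positivity) fun y => ?_
    rw [leftAct_apply]
    calc ‖h (y * x)‖ ≤ ‖h‖ * ‖y * x‖ := h.le_opNorm _
      _ ≤ ‖h‖ * (‖y‖ * ‖x‖) := by gcongr; exact norm_mul_le _ _
      _ = ‖h‖ * ‖x‖ * ‖y‖ := by ring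
  · refine ContinuousLinearMap.opNorm_le_bound _ (by positivity) fun y => ?_
    rw [rightAct_apply]
    calc ‖h (x * y)‖ ≤ ‖h‖ * ‖x * y‖ := h.le_opNorm _
      _ ≤ ‖h‖ * (‖x‖ * ‖y‖) := by gcongr; exact norm_mul_le _ _
      _ = ‖h‖ * ‖x‖ * ‖y‖ := by ring

/-- The sides switch because `(x · h) a = (h · a) x`: the norm of `x · h` is the support seminorm of
the right orbit of `h`. -/
theorem isReflexiveSpace_sideSpace_left {h : StrongDual 𝕜 A} (hh : IsRightAutoperiodic h) :
    IsReflexiveSpace 𝕜 (SideSpace .left h) := by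
  refine hh.isReflexiveSpace_seminormCompletion (sideSeminorm .left h)
    (sideSeminorm_le .left h) ?_ ?_
  · rintro _ ⟨a, ha, rfl⟩ x
    rw [mem_closedBall_zero_iff] at ha
    exact (leftAct h x).unit_le_opNorm a ha
  · intro x r hr
    have hr0 : 0 ≤ r := (norm_nonneg _).trans (hr _ ⟨0, by simp, rfl⟩)
    exact ContinuousLinearMap.opNorm_le_of_unit_norm hr0 fun a ha =>
      hr _ ⟨a, by simp [ha], rfl⟩

theorem isReflexiveSpace_sideSpace_right {h : StrongDual 𝕜 A} (hh : IsLeftAutoperiodic h) :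
    IsReflexiveSpace 𝕜 (SideSpace .right h) := by
  refine hh.isReflexiveSpace_seminormCompletion (sideSeminorm .right h)
    (sideSeminorm_le .right h) ?_ ?_
  · rintro _ ⟨a, ha, rfl⟩ x
    rw [mem_closedBall_zero_iff] at ha
    exact (rightAct h x).unit_le_opNorm a ha
  · intro x r hr
    have hr0 : 0 ≤ r := (norm_nonneg _).trans (hr _ ⟨0, by simp, rfl⟩)
    exact ContinuousLinearMap.opNorm_le_of_unit_norm hr0 fun a ha =>
      hr _ ⟨a, by simp [ha], rfl⟩

end Autocompact

noncomputable section

/-! ### Representations -/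

section Representations

variable {𝕜 : Type} [RCLike 𝕜] {A : Type u} [NonUnitalNormedRing A] [NormedSpace 𝕜 A]

/-- A multiplicative linear map into the bounded operators, as a representation. -/
def directRep {E : Type*} [NormedAddCommGroup E] [NormedSpace 𝕜 E] (σ : A →ₗ[𝕜] E →L[𝕜] E)
    (hσ : ∀ a b, σ (a * b) = (σ a).comp (σ b)) : OperatorRep 𝕜 A E where
  toFun := σ
  map_smul' := map_smul σ
  map_zero' := map_zero σ
  map_add' := map_add σ
  map_mul' := hσ

/-- The representation on the dual given by the transposes of an anti-multiplicative linear map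
into the bounded operators. -/
def transposeRep {E : Type*} [NormedAddCommGroup E] [NormedSpace 𝕜 E] (σ : A →ₗ[𝕜] E →L[𝕜] E)
    (hσ : ∀ a b, σ (a * b) = (σ b).comp (σ a)) : OperatorRep 𝕜 A (StrongDual 𝕜 E) where
  toFun a := ContinuousLinearMap.precomp 𝕜 (σ a)
  map_smul' c a := by ext φ x; simp
  map_zero' := by ext φ x; simp
  map_add' a b := by ext φ x; simp
  map_mul' a b := by ext φ x; simp [hσ]

theorem transposeRep_apply {E : Type*} [NormedAddCommGroup E] [NormedSpace 𝕜 E]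
    (σ : A →ₗ[𝕜] E →L[𝕜] E) (hσ : ∀ a b, σ (a * b) = (σ b).comp (σ a)) (a : A)
    (φ : StrongDual 𝕜 E) : transposeRep σ hσ a φ = φ.comp (σ a) := rfl

theorem isNormDecreasing_transposeRep {E : Type*} [NormedAddCommGroup E] [NormedSpace 𝕜 E]
    (σ : A →ₗ[𝕜] E →L[𝕜] E) (hσ : ∀ a b, σ (a * b) = (σ b).comp (σ a))
    (hσn : ∀ a, ‖σ a‖ ≤ ‖a‖) : IsNormDecreasing (transposeRep σ hσ) := fun a =>
  ContinuousLinearMap.opNorm_le_bound _ (norm_nonneg a) fun φ => by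
    rw [transposeRep_apply, mul_comm]
    exact (φ.opNorm_comp_le _).trans (by gcongr; exact hσn a)

theorem eq_zero_of_transposeRep_eq_zero {E : Type*} [NormedAddCommGroup E] [NormedSpace 𝕜 E]
    (σ : A →ₗ[𝕜] E →L[𝕜] E) (hσ : ∀ a b, σ (a * b) = (σ b).comp (σ a)) {a : A}
    (ha : transposeRep σ hσ a = 0) : σ a = 0 := by
  ext x
  refine SeparatingDual.eq_zero_of_forall_dual_eq_zero (R := 𝕜) fun φ => ?_
  have : transposeRep σ hσ a φ x = 0 := by rw [ha]; rfl
  exact this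

end Representations

/-! ### `ℓ²`-direct sums of representations -/

section LpRep

variable {𝕜 : Type*} [RCLike 𝕜] {ι : Type*} {E : ι → Type*} [∀ i, NormedAddCommGroup (E i)]
  [∀ i, NormedSpace 𝕜 (E i)]

theorem memℓp_two_of_norm_le_mul {f g : ∀ i, E i} (hf : Memℓp f 2) {C : ℝ}
    (h : ∀ i, ‖g i‖ ≤ C * ‖f i‖) : Memℓp g 2 := by
  have hs := hf.summable (by norm_num)
  refine memℓp_gen (Summable.of_nonneg_of_le (fun i => by positivity) (fun i => ?_)
    (hs.mul_left (C ^ 2)))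
  simp only [ENNReal.toReal_ofNat, Real.rpow_ofNat]
  rw [← mul_pow]
  exact pow_le_pow_left₀ (norm_nonneg _) (h i) 2

/-- The coordinatewise action of a bounded family of operators on an `ℓ²`-direct sum. -/
def lpTwoMap (T : ∀ i, E i →L[𝕜] E i) (C : ℝ) (hT : ∀ i, ‖T i‖ ≤ C) : lp E 2 →L[𝕜] lp E 2 :=
  LinearMap.mkContinuous
    { toFun f := ⟨fun i => T i (f i),
        memℓp_two_of_norm_le_mul (lp.memℓp f) fun i => (T i).le_of_opNorm_le (hT i) (f i)⟩
      map_add' f g := by ext i; exact map_add (T i) _ _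
      map_smul' c f := by ext i; exact map_smul (T i) _ _ }
    |C| fun f => by
      refine lp.norm_le_of_forall_sum_le (by norm_num) (by positivity) fun s => ?_
      simp only [ENNReal.toReal_ofNat, Real.rpow_ofNat]
      rw [mul_pow]
      refine le_trans ?_ (mul_le_mul_of_nonneg_left (lp.sum_sq_norm_le f s) (by positivity))
      rw [Finset.mul_sum]
      refine Finset.sum_le_sum fun i _ => ?_
      rw [← mul_pow]
      exact pow_le_pow_left₀ (norm_nonneg _)
        ((T i).le_of_opNorm_le ((hT i).trans (le_abs_self C)) (f i)) 2

theorem lpTwoMap_apply (T : ∀ i, E i →L[𝕜] E i) (C : ℝ) (hT : ∀ i, ‖T i‖ ≤ C) (f : lp E 2)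
    (i : ι) : lpTwoMap T C hT f i = T i (f i) := rfl

theorem norm_lpTwoMap_le (T : ∀ i, E i →L[𝕜] E i) {C : ℝ} (hC : 0 ≤ C) (hT : ∀ i, ‖T i‖ ≤ C) :
    ‖lpTwoMap T C hT‖ ≤ C :=
  (LinearMap.mkContinuous_norm_le _ (abs_nonneg C) _).trans_eq (abs_of_nonneg hC)

end LpRep

section LpRep

variable {𝕜 : Type} [RCLike 𝕜] {A : Type u} [NonUnitalNormedRing A] [NormedSpace 𝕜 A]
  {ι : Type*} {E : ι → Type*} [∀ i, NormedAddCommGroup (E i)] [∀ i, NormedSpace 𝕜 (E i)]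

/-- The `ℓ²`-direct sum of norm-decreasing representations. -/
def lpTwoRep (π : ∀ i, OperatorRep 𝕜 A (E i)) (hπ : ∀ i, IsNormDecreasing (π i)) :
    OperatorRep 𝕜 A (lp E 2) where
  toFun a := lpTwoMap (fun i => π i a) ‖a‖ fun i => hπ i a
  map_smul' c a := by ext f i; simp [lpTwoMap_apply]
  map_zero' := by ext f i; simp [lpTwoMap_apply]
  map_add' a b := by ext f i; simp [lpTwoMap_apply]
  map_mul' a b := by ext f i; simp [lpTwoMap_apply]

theorem lpTwoRep_apply (π : ∀ i, OperatorRep 𝕜 A (E i)) (hπ : ∀ i, IsNormDecreasing (π i))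
    (a : A) (f : lp E 2) (i : ι) : lpTwoRep π hπ a f i = π i a (f i) := rfl

theorem isNormDecreasing_lpTwoRep (π : ∀ i, OperatorRep 𝕜 A (E i))
    (hπ : ∀ i, IsNormDecreasing (π i)) : IsNormDecreasing (lpTwoRep π hπ) := fun a =>
  norm_lpTwoMap_le _ (norm_nonneg a) fun i => hπ i a

theorem eq_zero_of_lpTwoRep_eq_zero (π : ∀ i, OperatorRep 𝕜 A (E i))
    (hπ : ∀ i, IsNormDecreasing (π i)) {a : A} (ha : lpTwoRep π hπ a = 0) (i : ι) :
    π i a = 0 := by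
  classical
  ext v
  have h := lpTwoRep_apply π hπ a (lp.single 2 i v) i
  rw [lp.single_apply_self, ha] at h
  exact h.symm

end LpRep

/-! ### Multiplication operators on the spaces attached to a functional -/

section SideOperators

variable {𝕜 : Type} [RCLike 𝕜] {A : Type u} [NonUnitalNormedRing A] [NormedSpace 𝕜 A]
  [IsScalarTower 𝕜 A A] [SMulCommClass 𝕜 A A]

variable (𝕜 A) in
/-- The multiplication of `A` for the label `left`, the opposite one for the label `right`. -/
def sideMul (s : Side) : A →ₗ[𝕜] A →ₗ[𝕜] A :=
  match s with
  | .left => LinearMap.mul 𝕜 A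
  | .right => (LinearMap.mul 𝕜 A).flip

theorem sideMul_sideMul (s : Side) (a b x : A) :
    sideMul 𝕜 A s (sideMul 𝕜 A s a b) x = sideMul 𝕜 A s a (sideMul 𝕜 A s b x) := by
  cases s
  · exact mul_assoc a b x
  · exact (mul_assoc x b a).symm

theorem sideSeminorm_sideMul_le (s : Side) (h : StrongDual 𝕜 A) (a x : A) :
    sideSeminorm s h (sideMul 𝕜 A s a x) ≤ ‖a‖ * sideSeminorm s h x := by
  cases s
  · exact sideSeminorm_left_mul_le h a x
  · exact sideSeminorm_right_mul_le h a x

/-- For the label `left`, `h (a * x)` is the value of `x · h` at `a`. Thus `x ↦ h (a * x)` extends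
to `SideSpace`, although `h` itself need not. -/
theorem norm_apply_sideMul_le (s : Side) (h : StrongDual 𝕜 A) (a x : A) :
    ‖h (sideMul 𝕜 A s a x)‖ ≤ ‖a‖ * sideSeminorm s h x := by
  rw [mul_comm]
  cases s
  · exact (leftAct h x).le_opNorm a
  · exact (rightAct h x).le_opNorm a

/-- The canonical map from `A` to its completion `SideSpace s h`. -/
def sideCoe (s : Side) (h : StrongDual 𝕜 A) : A →ₗ[𝕜] SideSpace s h :=
  (UniformSpace.Completion.toComplL (𝕜 := 𝕜)).toLinearMap ∘ₗ
    (WithSeminorm.of (sideSeminorm s h)).toLinearMap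

theorem norm_sideCoe (s : Side) (h : StrongDual 𝕜 A) (x : A) :
    ‖sideCoe s h x‖ = sideSeminorm s h x :=
  UniformSpace.Completion.norm_coe _

theorem sideSpace_ext {s : Side} {h : StrongDual 𝕜 A} {F : Type*} [NormedAddCommGroup F]
    [NormedSpace 𝕜 F] {S T : SideSpace s h →L[𝕜] F}
    (hST : ∀ x, S (sideCoe s h x) = T (sideCoe s h x)) : S = T := by
  ext y
  induction y using UniformSpace.Completion.induction_on with
  | hp => exact isClosed_eq S.continuous T.continuous
  | ih x => exact hST x

/-- The operator on `SideSpace s h` induced by multiplication with `a` from the side `s`. -/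
def sideMulOp (s : Side) (h : StrongDual 𝕜 A) (a : A) : SideSpace s h →L[𝕜] SideSpace s h :=
  (WithSeminorm.mapCLM (sideSeminorm s h) (sideMul 𝕜 A s a) ‖a‖
    (sideSeminorm_sideMul_le s h a)).completion

theorem sideMulOp_sideCoe (s : Side) (h : StrongDual 𝕜 A) (a x : A) :
    sideMulOp s h a (sideCoe s h x) = sideCoe s h (sideMul 𝕜 A s a x) :=
  ContinuousLinearMap.completion_apply_coe _ _

theorem norm_sideMulOp_le (s : Side) (h : StrongDual 𝕜 A) (a : A) : ‖sideMulOp s h a‖ ≤ ‖a‖ := by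
  have key : ∀ x, ‖sideMulOp s h a (sideCoe s h x)‖ ≤ ‖a‖ * ‖sideCoe s h x‖ := fun x => by
    rw [sideMulOp_sideCoe, norm_sideCoe, norm_sideCoe]
    exact sideSeminorm_sideMul_le s h a x
  refine ContinuousLinearMap.opNorm_le_bound _ (norm_nonneg a) fun y => ?_
  induction y using UniformSpace.Completion.induction_on with
  | hp => exact isClosed_le (by fun_prop) (by fun_prop)
  | ih x => exact key x

/-- `sideMulOp` as a linear map. -/
def sideMulLin (s : Side) (h : StrongDual 𝕜 A) : A →ₗ[𝕜] SideSpace s h →L[𝕜] SideSpace s h where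
  toFun := sideMulOp s h
  map_add' a b := sideSpace_ext fun x => by simp [sideMulOp_sideCoe]
  map_smul' c a := sideSpace_ext fun x => by simp [sideMulOp_sideCoe]

theorem sideMulLin_apply (s : Side) (h : StrongDual 𝕜 A) (a : A) :
    sideMulLin s h a = sideMulOp s h a := rfl

theorem sideMulLin_sideMul (s : Side) (h : StrongDual 𝕜 A) (a b : A) :
    sideMulLin s h (sideMul 𝕜 A s a b) = (sideMulLin s h a).comp (sideMulLin s h b) :=
  sideSpace_ext fun x => by
    simp [sideMulLin_apply, sideMulOp_sideCoe, sideMul_sideMul]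

/-- The representation of `A` on `RepSpace s h`. -/
def sideRep (s : Side) (h : StrongDual 𝕜 A) : OperatorRep 𝕜 A (RepSpace s h) :=
  match s with
  | .left => directRep (sideMulLin .left h) (sideMulLin_sideMul .left h)
  | .right => transposeRep (sideMulLin .right h) fun a b => sideMulLin_sideMul .right h b a

theorem sideRep_apply (s : Side) (h : StrongDual 𝕜 A) (a : A) (v : RepSpace s h) :
    sideRep s h a v = repOp s h a v := by
  cases s <;> rfl

theorem isNormDecreasing_sideRep (s : Side) (h : StrongDual 𝕜 A) :
    IsNormDecreasing (sideRep s h) := by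
  cases s
  · exact norm_sideMulOp_le .left h
  · exact isNormDecreasing_transposeRep _ (fun a b => sideMulLin_sideMul .right h b a)
      (norm_sideMulOp_le .right h)

theorem sideMulOp_eq_zero_of_sideRep_eq_zero {s : Side} {h : StrongDual 𝕜 A} {a : A}
    (ha : sideRep s h a = 0) : sideMulOp s h a = 0 := by
  cases s
  · exact ha
  · exact eq_zero_of_transposeRep_eq_zero _ (fun a b => sideMulLin_sideMul .right h b a) ha

/-- Acting on the class of `e` shows that the class of `a` vanishes, and `h a = h (e * a)`, or `h (a
* e)` for the label `right`, is controlled by the seminorm of `a`. -/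
theorem apply_eq_zero_of_sideMulOp_eq_zero {s : Side} {h : StrongDual 𝕜 A} {a e : A}
    (he : ∀ x, e * x = x ∧ x * e = x) (ha : sideMulOp s h a = 0) : h a = 0 := by
  have h1 := norm_sideCoe s h (sideMul 𝕜 A s a e)
  rw [← sideMulOp_sideCoe, ha] at h1
  have h2 := norm_apply_sideMul_le s h e (sideMul 𝕜 A s a e)
  rw [← h1] at h2
  have h3 : sideMul 𝕜 A s e (sideMul 𝕜 A s a e) = a := by
    cases s
    · exact ((he _).1).trans (he a).2
    · exact ((he _).2).trans (he a).1
  simpa [h3] using h2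

theorem isReflexiveSpace_sideSpace {s : Side} {h : StrongDual 𝕜 A}
    (hs : (s = .left ∧ IsRightAutoperiodic h) ∨ (s = .right ∧ IsLeftAutoperiodic h)) :
    IsReflexiveSpace 𝕜 (SideSpace s h) := by
  rcases hs with ⟨rfl, hh⟩ | ⟨rfl, hh⟩
  · exact isReflexiveSpace_sideSpace_left hh
  · exact isReflexiveSpace_sideSpace_right hh

theorem isReflexiveSpace_repSpace {s : Side} {h : StrongDual 𝕜 A}
    (hs : IsReflexiveSpace 𝕜 (SideSpace s h)) : IsReflexiveSpace 𝕜 (RepSpace s h) := by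
  cases s
  · exact hs
  · exact hs.dual

instance instCompleteSpaceRepSpace (s : Side) (h : StrongDual 𝕜 A) :
    CompleteSpace (RepSpace s h) :=
  match s with
  | .left => inferInstanceAs (CompleteSpace (SideSpace .left h))
  | .right => inferInstanceAs (CompleteSpace (StrongDual 𝕜 (SideSpace .right h)))

end SideOperators


/-! ### Faithful representations of algebras without identity -/

section Extension

variable {𝕜 : Type} [RCLike 𝕜] {A : Type u} [NonUnitalNormedRing A] [NormedSpace 𝕜 A]

/-- A nonzero scalar `c` with `‖c‖ * ‖h‖ ≤ 1`. -/
def normalizer (h : StrongDual 𝕜 A) : 𝕜 := ((‖h‖ + 1 : ℝ) : 𝕜)⁻¹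

theorem normalizer_ne_zero (h : StrongDual 𝕜 A) : normalizer h ≠ 0 := by
  have : 0 < ‖h‖ + 1 := by positivity
  exact inv_ne_zero (by exact_mod_cast this.ne')

theorem norm_normalizer_mul_le (h : StrongDual 𝕜 A) : ‖normalizer h‖ * ‖h‖ ≤ 1 := by
  rw [normalizer, norm_inv, RCLike.norm_ofReal, abs_of_pos (by positivity),
    inv_mul_le_one₀ (by positivity)]
  linarith

variable [IsScalarTower 𝕜 A A] [SMulCommClass 𝕜 A A]

/-- The functional on `SideSpace s h` induced by `x ↦ h (a * x)` for the label `left`, and by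
`x ↦ h (x * a)` for the label `right`. -/
def sideFunctional (s : Side) (h : StrongDual 𝕜 A) (a : A) : StrongDual 𝕜 (SideSpace s h) :=
  extendDual 𝕜 (WithSeminorm (sideSeminorm s h)) <|
    LinearMap.mkContinuous
      (h.toLinearMap ∘ₗ sideMul 𝕜 A s a ∘ₗ (WithSeminorm.of (sideSeminorm s h)).symm.toLinearMap)
      ‖a‖ fun x => norm_apply_sideMul_le s h a ((WithSeminorm.of (sideSeminorm s h)).symm x)

theorem sideFunctional_sideCoe (s : Side) (h : StrongDual 𝕜 A) (a x : A) :
    sideFunctional s h a (sideCoe s h x) = h (sideMul 𝕜 A s a x) :=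
  extendDual_apply_coe _ _

theorem norm_sideFunctional_le (s : Side) (h : StrongDual 𝕜 A) (a : A) :
    ‖sideFunctional s h a‖ ≤ ‖a‖ :=
  (norm_fromCompletion_le _).trans (LinearMap.mkContinuous_norm_le _ (norm_nonneg a) _)

theorem sideFunctional_add (s : Side) (h : StrongDual 𝕜 A) (a b : A) :
    sideFunctional s h (a + b) = sideFunctional s h a + sideFunctional s h b :=
  sideSpace_ext fun x => by simp [sideFunctional_sideCoe]

theorem sideFunctional_smul (s : Side) (h : StrongDual 𝕜 A) (c : 𝕜) (a : A) :
    sideFunctional s h (c • a) = c • sideFunctional s h a :=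
  sideSpace_ext fun x => by simp [sideFunctional_sideCoe]

theorem sideFunctional_sideMul (s : Side) (h : StrongDual 𝕜 A) (a b : A) :
    sideFunctional s h (sideMul 𝕜 A s a b) = (sideFunctional s h a).comp (sideMulOp s h b) :=
  sideSpace_ext fun x => by
    simp [sideFunctional_sideCoe, sideMulOp_sideCoe, sideMul_sideMul]

/-- The space `SideSpace s h` enlarged by two scalar coordinates: a model of the space attached to
the extension of `h` to the unitization of `A`. -/
abbrev SideExt (s : Side) (h : StrongDual 𝕜 A) : Type u :=
  WithLp 1 (SideSpace s h × 𝕜) × 𝕜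

/-- The action of `a` on `SideExt s h` as a linear map. -/
def sideExtLinearMap (s : Side) (h : StrongDual 𝕜 A) (a : A) :
    SideExt s h →ₗ[𝕜] SideExt s h where
  -- The coordinates are a vector, the coefficient of the adjoined unit and a value of `h`. The unit
  -- is sent to `a`, scaled by `normalizer h` to keep the norm at most `‖a‖`; the last coordinate
  -- records `h` of the product.
  toFun x := (WithLp.toLp 1 (sideMulOp s h a x.1.fst + x.1.snd • normalizer h • sideCoe s h a, 0),
    sideFunctional s h a x.1.fst + x.1.snd * (normalizer h * h a))
  map_add' x y := by
    refine Prod.ext (WithLp.ofLp_injective _ (Prod.ext ?_ ?_)) ?_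
    · simp; module
    · simp
    · simp; ring
  map_smul' c x := by
    refine Prod.ext (WithLp.ofLp_injective _ (Prod.ext ?_ ?_)) ?_
    · simp; module
    · simp
    · simp; ring

theorem norm_sideExtLinearMap_le (s : Side) (h : StrongDual 𝕜 A) (a : A) (x : SideExt s h) :
    ‖sideExtLinearMap s h a x‖ ≤ ‖a‖ * ‖x‖ := by
  -- The `ℓ¹` norm on the first two coordinates is needed since both contribute to each nonzero
  -- output; the third input contributes to none, so the maximum norm suffices there.
  have hx : ‖x.1.fst‖ + ‖x.1.snd‖ ≤ ‖x‖ := by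
    rw [← WithLp.prod_norm_eq_of_L1]
    exact norm_fst_le x
  have hc := norm_normalizer_mul_le h
  have h1 : ‖normalizer h • sideCoe s h a‖ ≤ ‖a‖ := by
    rw [norm_smul, norm_sideCoe]
    calc ‖normalizer h‖ * sideSeminorm s h a ≤ ‖normalizer h‖ * (‖h‖ * ‖a‖) := by
          gcongr; exact sideSeminorm_le s h a
      _ = (‖normalizer h‖ * ‖h‖) * ‖a‖ := by ring
      _ ≤ ‖a‖ := mul_le_of_le_one_left (norm_nonneg a) hc
  have h2 : ‖normalizer h * h a‖ ≤ ‖a‖ := by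
    rw [norm_mul]
    calc ‖normalizer h‖ * ‖h a‖ ≤ ‖normalizer h‖ * (‖h‖ * ‖a‖) := by
          gcongr; exact h.le_opNorm a
      _ = (‖normalizer h‖ * ‖h‖) * ‖a‖ := by ring
      _ ≤ ‖a‖ := mul_le_of_le_one_left (norm_nonneg a) hc
  refine (norm_prod_le_iff.2 ⟨?_, ?_⟩).trans (mul_le_mul_of_nonneg_left hx (norm_nonneg a))
  · rw [WithLp.prod_norm_eq_of_L1]
    change ‖sideMulOp s h a x.1.fst + x.1.snd • normalizer h • sideCoe s h a‖ + ‖(0 : 𝕜)‖ ≤ _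
    rw [norm_zero, add_zero, mul_add]
    refine norm_add_le_of_le ((sideMulOp s h a).le_of_opNorm_le (norm_sideMulOp_le s h a) _) ?_
    rw [norm_smul, mul_comm]
    gcongr
  · change ‖sideFunctional s h a x.1.fst + x.1.snd * (normalizer h * h a)‖ ≤ _
    rw [mul_add]
    refine norm_add_le_of_le
      ((sideFunctional s h a).le_of_opNorm_le (norm_sideFunctional_le s h a) _) ?_
    rw [norm_mul, mul_comm]
    gcongr

/-- The action of `A` on `SideExt s h`. -/
def sideExtLin (s : Side) (h : StrongDual 𝕜 A) : A →ₗ[𝕜] SideExt s h →L[𝕜] SideExt s h where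
  toFun a := (sideExtLinearMap s h a).mkContinuous ‖a‖ (norm_sideExtLinearMap_le s h a)
  map_add' a b := by
    refine ContinuousLinearMap.ext fun x =>
      Prod.ext (WithLp.ofLp_injective _ (Prod.ext ?_ ?_)) ?_
    · simp [sideExtLinearMap, ← sideMulLin_apply]; module
    · simp [sideExtLinearMap]
    · simp [sideExtLinearMap, sideFunctional_add]; ring
  map_smul' c a := by
    refine ContinuousLinearMap.ext fun x =>
      Prod.ext (WithLp.ofLp_injective _ (Prod.ext ?_ ?_)) ?_
    · simp [sideExtLinearMap, ← sideMulLin_apply]; module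
    · simp [sideExtLinearMap]
    · simp [sideExtLinearMap, sideFunctional_smul]; ring

theorem norm_sideExtLin_le (s : Side) (h : StrongDual 𝕜 A) (a : A) : ‖sideExtLin s h a‖ ≤ ‖a‖ :=
  LinearMap.mkContinuous_norm_le _ (norm_nonneg a) (norm_sideExtLinearMap_le s h a)

/-- After one action the unit coefficient is zero and the old third coordinate is forgotten, so only
the associativity relations for `sideMulOp` and `sideFunctional` remain. -/
theorem sideExtLin_sideMul (s : Side) (h : StrongDual 𝕜 A) (a b : A) :
    sideExtLin s h (sideMul 𝕜 A s a b) = (sideExtLin s h a).comp (sideExtLin s h b) := by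
  refine ContinuousLinearMap.ext fun x =>
    Prod.ext (WithLp.ofLp_injective _ (Prod.ext ?_ ?_)) ?_
  · have := congrArg (fun T => T x.1.fst) (sideMulLin_sideMul s h a b)
    simp only [sideMulLin_apply, ContinuousLinearMap.comp_apply] at this
    simp [sideExtLin, sideExtLinearMap, sideMulOp_sideCoe, this]
  · simp [sideExtLin, sideExtLinearMap]
  · simp [sideExtLin, sideExtLinearMap, sideFunctional_sideMul, sideFunctional_sideCoe]

/-- The adjoined unit `(0, 1, 0)` is sent to a vector with last coordinate `normalizer h * h a`. -/
theorem apply_eq_zero_of_sideExtLin_eq_zero {s : Side} {h : StrongDual 𝕜 A} {a : A}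
    (ha : sideExtLin s h a = 0) : h a = 0 := by
  have h1 : (sideExtLin s h a (WithLp.toLp 1 (0, 1), 0)).2 = 0 := by rw [ha]; rfl
  have h2 : sideFunctional s h a 0 + 1 * (normalizer h * h a) = 0 := h1
  rw [map_zero, zero_add, one_mul] at h2
  exact (mul_eq_zero.1 h2).resolve_left (normalizer_ne_zero h)

theorem isReflexiveSpace_sideExt {s : Side} {h : StrongDual 𝕜 A}
    (hs : IsReflexiveSpace 𝕜 (SideSpace s h)) : IsReflexiveSpace 𝕜 (SideExt s h) :=
  ((hs.prod .self).congr (WithLp.prodContinuousLinearEquiv 1 𝕜 (SideSpace s h) 𝕜).symm).prod .self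

/-- Every autoperiodic functional `h` has a norm-decreasing representation on a reflexive Banach
space whose kernel is contained in the kernel of `h`. -/
theorem exists_operatorRep_of_mem_autoperiodicFunctionals {h : StrongDual 𝕜 A}
    (hh : h ∈ autoperiodicFunctionals 𝕜 A) :
    ∃ (E : Type u) (_ : NormedAddCommGroup E) (_ : NormedSpace 𝕜 E) (_ : CompleteSpace E)
      (π : OperatorRep 𝕜 A E),
      IsReflexiveSpace 𝕜 E ∧ IsNormDecreasing π ∧ ∀ a, π a = 0 → h a = 0 := by
  rcases hh with hh | hh
  · exact ⟨SideExt .left h, inferInstance, inferInstance, inferInstance,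
      directRep (sideExtLin .left h) (sideExtLin_sideMul .left h),
      isReflexiveSpace_sideExt (isReflexiveSpace_sideSpace_left hh), norm_sideExtLin_le .left h,
      fun a ha => apply_eq_zero_of_sideExtLin_eq_zero ha⟩
  · have hmul : ∀ a b, sideExtLin .right h (a * b) =
        (sideExtLin .right h b).comp (sideExtLin .right h a) := fun a b =>
      sideExtLin_sideMul .right h b a
    exact ⟨StrongDual 𝕜 (SideExt .right h), inferInstance, inferInstance, inferInstance,
      transposeRep (sideExtLin .right h) hmul,
      (isReflexiveSpace_sideExt (isReflexiveSpace_sideSpace_right hh)).dual,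
      isNormDecreasing_transposeRep _ hmul (norm_sideExtLin_le .right h),
      fun a ha => apply_eq_zero_of_sideExtLin_eq_zero
        (eq_zero_of_transposeRep_eq_zero _ hmul ha)⟩

end Extension

end

/-! ### The main theorem -/

theorem mainTheorem1 {𝕜 : Type} [RCLike 𝕜] {A : Type u} [NonUnitalNormedRing A] [NormedSpace 𝕜 A]
    [IsScalarTower 𝕜 A A] [SMulCommClass 𝕜 A A] [CompleteSpace A]
    (B : Submodule 𝕜 (StrongDual 𝕜 A))
    (hB : (B : Set (StrongDual 𝕜 A)) ⊆ autoperiodicFunctionals 𝕜 A)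
    (hsep : ∀ x y : A, x ≠ y → ∃ h ∈ B, h x ≠ h y) :
    -- a faithful norm-decreasing representation on a reflexive Banach space
    (∃ (E : Type u) (_ : NormedAddCommGroup E) (_ : NormedSpace 𝕜 E) (_ : CompleteSpace E)
      (π : OperatorRep 𝕜 A E),
      IsReflexiveSpace 𝕜 E ∧ IsNormDecreasing π ∧ Function.Injective π) ∧
    -- the construction from the spaces `A_{l,h}` and `A_{r,h}`
    (∀ s : B → Side,
      (∀ h : B, (s h = .left ∧ IsRightAutoperiodic (h : StrongDual 𝕜 A)) ∨
        (s h = .right ∧ IsLeftAutoperiodic (h : StrongDual 𝕜 A))) →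
      (∀ h : B, IsReflexiveSpace 𝕜 (SideSpace (s h) (h : StrongDual 𝕜 A))) ∧
      IsReflexiveSpace 𝕜 (SideSum B s) ∧
      CompleteSpace (RepSum B s) ∧
      IsReflexiveSpace 𝕜 (RepSum B s) ∧
      ∃ π : OperatorRep 𝕜 A (RepSum B s),
        (∀ (a : A) (f : RepSum B s) (h : B), π a f h = repOp (s h) (h : StrongDual 𝕜 A) a (f h)) ∧
        IsNormDecreasing π ∧
        ((∃ e : A, ∀ x, e * x = x ∧ x * e = x) → Function.Injective π)) := by
  have hzero : ∀ a : A, (∀ h ∈ B, h a = 0) → a = 0 := fun a ha => by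
    by_contra hne
    obtain ⟨h, hh, hha⟩ := hsep a 0 hne
    exact hha (by rw [ha h hh, map_zero])
  refine ⟨?_, fun s hs => ?_⟩
  · choose E i₁ i₂ i₃ π hE hπ hker using fun h : B =>
      exists_operatorRep_of_mem_autoperiodicFunctionals (hB h.2)
    refine ⟨lp E 2, inferInstance, inferInstance, inferInstance, lpTwoRep π hπ, .lpTwo hE,
      isNormDecreasing_lpTwoRep π hπ, ?_⟩
    refine (injective_iff_map_eq_zero _).2 fun a ha => hzero a fun h hh => ?_
    exact hker ⟨h, hh⟩ a (eq_zero_of_lpTwoRep_eq_zero π hπ ha ⟨h, hh⟩)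
  · have hside : ∀ h : B, IsReflexiveSpace 𝕜 (SideSpace (s h) (h : StrongDual 𝕜 A)) := fun h =>
      isReflexiveSpace_sideSpace (hs h)
    have hπ : ∀ h : B, IsNormDecreasing (sideRep (s h) (h : StrongDual 𝕜 A)) := fun h =>
      isNormDecreasing_sideRep _ _
    refine ⟨hside, .lpTwo hside, inferInstance, .lpTwo fun h => isReflexiveSpace_repSpace (hside h),
      lpTwoRep (fun h : B => sideRep (s h) (h : StrongDual 𝕜 A)) hπ,
      fun a f h => sideRep_apply _ _ a (f h), isNormDecreasing_lpTwoRep _ hπ, ?_⟩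
    rintro ⟨e, he⟩
    refine (injective_iff_map_eq_zero _).2 fun a ha => hzero a fun h hh => ?_
    have h0 : sideRep (s ⟨h, hh⟩) h a = 0 :=
      eq_zero_of_lpTwoRep_eq_zero (E := fun h : B => RepSpace (s h) (h : StrongDual 𝕜 A))
        (fun h : B => sideRep (s h) (h : StrongDual 𝕜 A)) hπ (a := a) ha ⟨h, hh⟩
    exact apply_eq_zero_of_sideMulOp_eq_zero he (sideMulOp_eq_zero_of_sideRep_eq_zero h0)
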